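/- **Setting.** Let $n\ge 2$, $T_A\ge T_B>0$, and let $v_{A,i},v_{B,i}>0$ ($i\in[n]$) satisfy $\sum_i v_{A,i}=\sum_i v_{B,i}=1$. In the Blotto game, a mixed strategy of player $P\in\{A,B\}$ is a probability distribution on $\mathbb R_{\ge 0}^n$ whose draw $X_P=(X_{P,1},\dots,X_{P,n})$ satisfies $\sum_i X_{P,i}\le T_P$ almost surely. The players draw $X_A$ and $X_B$ independently; on each battlefield $i$ the player with the strictly larger allocation wins, and the winner $P$ receives $v_{P,i}$. Ties are broken by an arbitrary fixed (possibly randomized) measurable rule. A Nash equilibrium is a pair of mixed strategies such that no player can increase her expected total reward by switching to another mixed strategy satisfying her almost-sure budget constraint. Let $\gamma^*>0$ and $\lambda^*>0$ be parameters of the Kovenock–Roberson Lotto equilibrium, that is, $$\lambda^*T_A=\frac12\sum_{i=1}^n(\gamma^* v_{B,i})\wedge\frac{v_{A,i}^2}{\gamma^* v_{B,i}},\qquad \lambda^*T_B=\frac12\sum_{i=1}^n\frac{(\gamma^* v_{B,i})^2}{v_{A,i}}\wedge v_{A,i}.$$ The associated Lotto marginals are, if $v_{A,i}/v_{B,i}\ge\gamma^*$,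 $$X_{A,i}\sim \mathsf{Unif}\Big[0,\tfrac{\gamma^* v_{B,i}}{\lambda^*}\Big],\qquad X_{B,i}\sim\Big(1-\tfrac{\gamma^* v_{B,i}}{v_{A,i}}\Big)\delta_0+\tfrac{\gamma^* v_{B,i}}{v_{A,i}}\,\mathsf{Unif}\Big[0,\tfrac{\gamma^* v_{B,i}}{\lambda^*}\Big],$$ and, if $v_{A,i}/v_{B,i}<\gamma^*$, $$X_{A,i}\sim\Big(1-\tfrac{v_{A,i}}{\gamma^* v_{B,i}}\Big)\delta_0+\tfrac{v_{A,i}}{\gamma^* v_{B,i}}\,\mathsf{Unif}\Big[0,\tfrac{v_{A,i}}{\lambda^*}\Big],\qquad X_{B,i}\sim \mathsf{Unif}\Big[0,\tfrac{v_{A,i}}{\lambda^*}\Big].$$ **Theorem.** There exist a joint distribution of $(X_{A,1},\dots,X_{A,n})$ and a joint distribution of $(X_{B,1},\dots,X_{B,n})$ with these marginals that together form a Nash equilibrium of the Blotto game if and only if $$\max_{i\in[n]}\big(\gamma^* v_{B,i}\wedge v_{A,i}\big)\le\lambda^*T_B .$$ -/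

import Mathlib

open MeasureTheory ProbabilityTheory

noncomputable section

namespace Blotto

/-- The datum of a two-player Blotto game on `n ≥ 2` battlefields: budgets `TA ≥ TB > 0`, and
positive battlefield values `vA i`, `vB i`, normalised to have total one for each player. -/
structure Game (n : ℕ) where
  two_le : 2 ≤ n
  TA : ℝ
  TB : ℝ
  vA : Fin n → ℝ
  vB : Fin n → ℝ
  TB_pos : 0 < TB
  TB_le_TA : TB ≤ TA
  vA_pos : ∀ i, 0 < vA i
  vB_pos : ∀ i, 0 < vB i
  sum_vA : ∑ i, vA i = 1
  sum_vB : ∑ i, vB i = 1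

/-- A rule for breaking ties: `shareA i x y` is the probability that player `A` is declared the
winner of battlefield `i` when the allocations `x` (of `A`) and `y` (of `B`) tie there;
`B` is the winner with the complementary probability. -/
structure TieRule (n : ℕ) where
  shareA : Fin n → (Fin n → ℝ) → (Fin n → ℝ) → ℝ
  measurable_shareA : ∀ i, Measurable fun z : (Fin n → ℝ) × (Fin n → ℝ) => shareA i z.1 z.2
  shareA_nonneg : ∀ i x y, 0 ≤ shareA i x y
  shareA_le_one : ∀ i x y, shareA i x y ≤ 1

/-- An admissible mixed strategy with budget `T`: a probability distribution over nonnegative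
allocation vectors whose total is at most `T` almost surely. -/
structure IsAdmissible {n : ℕ} (T : ℝ) (μ : Measure (Fin n → ℝ)) : Prop where
  isProbabilityMeasure : IsProbabilityMeasure μ
  nonneg : ∀ᵐ x ∂μ, ∀ i, 0 ≤ x i
  budget : ∀ᵐ x ∂μ, ∑ i, x i ≤ T

variable {n : ℕ}

/-- Reward of player `A` when `A` plays `x` and `B` plays `y`. -/
def payoffA (G : Game n) (τ : TieRule n) (x y : Fin n → ℝ) : ℝ :=
  ∑ i, G.vA i * (if y i < x i then 1 else if x i = y i then τ.shareA i x y else 0)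

/-- Reward of player `B` when `A` plays `x` and `B` plays `y`. -/
def payoffB (G : Game n) (τ : TieRule n) (x y : Fin n → ℝ) : ℝ :=
  ∑ i, G.vB i * (if x i < y i then 1 else if x i = y i then 1 - τ.shareA i x y else 0)

/-- Expected reward of `A` when the players draw independently from `μ` (for `A`), `ν` (for `B`). -/
def expectedA (G : Game n) (τ : TieRule n) (μ ν : Measure (Fin n → ℝ)) : ℝ :=
  ∫ z, payoffA G τ z.1 z.2 ∂(μ.prod ν)

/-- Expected reward of `B` when the players draw independently from `μ` (for `A`), `ν` (for `B`). -/
def expectedB (G : Game n) (τ : TieRule n) (μ ν : Measure (Fin n → ℝ)) : ℝ :=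
  ∫ z, payoffB G τ z.1 z.2 ∂(μ.prod ν)

/-- `(μ, ν)` is a Nash equilibrium of the Blotto game: both strategies satisfy the almost-sure
budget constraint, and no player gains by deviating to another such strategy. -/
structure IsNash (G : Game n) (τ : TieRule n) (μ ν : Measure (Fin n → ℝ)) : Prop where
  admissibleA : IsAdmissible G.TA μ
  admissibleB : IsAdmissible G.TB ν
  optimalA : ∀ μ' : Measure (Fin n → ℝ), IsAdmissible G.TA μ' →
    expectedA G τ μ' ν ≤ expectedA G τ μ ν
  optimalB : ∀ ν' : Measure (Fin n → ℝ), IsAdmissible G.TB ν' →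
    expectedB G τ μ ν' ≤ expectedB G τ μ ν

/-- The uniform distribution on `[0, b]`. -/
def unif (b : ℝ) : Measure ℝ := ProbabilityTheory.cond volume (Set.Icc 0 b)

/-- The mixture `(1 - p) δ₀ + p Unif[0, b]`. -/
def mixture (p b : ℝ) : Measure ℝ :=
  ENNReal.ofReal (1 - p) • Measure.dirac 0 + ENNReal.ofReal p • unif b

/-- Battlefields that are at least `γ` times more valuable to `A` than to `B`. -/
def highSet (G : Game n) (γ : ℝ) : Set (Fin n) := {i | γ ≤ G.vA i / G.vB i}

open Classical in
/-- Lotto marginal of player `A` on battlefield `i`. -/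
def lottoA (G : Game n) (γ l : ℝ) (i : Fin n) : Measure ℝ :=
  if i ∈ highSet G γ then unif (γ * G.vB i / l)
  else mixture (G.vA i / (γ * G.vB i)) (G.vA i / l)

open Classical in
/-- Lotto marginal of player `B` on battlefield `i`. -/
def lottoB (G : Game n) (γ l : ℝ) (i : Fin n) : Measure ℝ :=
  if i ∈ highSet G γ then mixture (γ * G.vB i / G.vA i) (γ * G.vB i / l)
  else unif (G.vA i / l)

/-- `(γ, l)` are parameters of the Kovenock–Roberson Lotto equilibrium: they are positive and solve
the two equations saying that the expected budgets are exhausted. -/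
structure IsLottoParams (G : Game n) (γ l : ℝ) : Prop where
  gamma_pos : 0 < γ
  lambda_pos : 0 < l
  budgetA : l * G.TA = (1 / 2) * ∑ i, min (γ * G.vB i) (G.vA i ^ 2 / (γ * G.vB i))
  budgetB : l * G.TB = (1 / 2) * ∑ i, min ((γ * G.vB i) ^ 2 / G.vA i) (G.vA i)

/-- `μ` is a coupling of the one-dimensional distributions `m i`. -/
def IsCoupling (m : Fin n → Measure ℝ) (μ : Measure (Fin n → ℝ)) : Prop :=
  ∀ i, μ.map (fun x => x i) = m i

end Blotto

end

/-! Write both marginals on battlefield `i` as (1 - p) δ₀ + p Unif[0, h], with the same h for both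
players and p = 1 for at least one of them. Against such a law an allocation x ≤ h wins with
probability 1 - p + p x / h, up to ties, and p times the battlefield value divided by h does not
depend on `i`. The opponent's reward is therefore at most affine in her total allocation, with
equality almost surely under her own Lotto marginals. Hence any budget-respecting couplings form an
equilibrium under any tie rule (`expected_le_of_lotto`), and only existence of the couplings is at
stake. Necessity is clear: `B`'s marginals charge allocations up to h, so h ≤ T_B.

Sufficiency is joint mixability (`exists_coupling_mixture`): laws of total mean T with all h ≤ T can
be coupled on the simplex of vectors with sum T. By duality (`exists_coupling_of_nonneg`) it is
enough that ∑ f i (x i) ≥ 0 on the simplex forces the sum of the integrals to be nonnegative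
(`sum_mixture_nonneg`). With F i t the mean of f i over [0, t], each integral is a convex
combination of F i 0 and F i (h i). A Lagrange multiplier c replaces these points by minimizers s i
of F i t - c t, whose sum can be placed in [T, 2T]. The uniform laws on suitable intervals [s i - ℓ
i, s i] do have a coupling with constant sum T (`avg_polygon_nonneg`, in dual form), and minimality
of s i compares their means with F i (s i). -/

namespace Blotto

/-! ### Constant-sum couplings of uniform laws, in dual form -/

/-- The average of `f` over the segment with endpoints `a` and `s`. -/
noncomputable def avg (f : ℝ → ℝ) (a s : ℝ) : ℝ := ∫ t in (0 : ℝ)..1, f (a + (s - a) * t)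

lemma continuous_avg {f : ℝ → ℝ} (hf : Continuous f) :
    Continuous fun z : ℝ × ℝ => avg f z.1 z.2 := by
  unfold avg
  exact intervalIntegral.continuous_parametric_intervalIntegral_of_continuous'
    (f := fun (z : ℝ × ℝ) (t : ℝ) => f (z.1 + (z.2 - z.1) * t))
    (hf.comp (by fun_prop)) 0 1

@[simp] lemma avg_self (f : ℝ → ℝ) (a : ℝ) : avg f a a = f a := by simp [avg]

lemma sub_mul_avg (f : ℝ → ℝ) (a s : ℝ) : (s - a) * avg f a s = ∫ x in a..s, f x := by
  simp [avg]

lemma avg_comm (f : ℝ → ℝ) (a s : ℝ) : avg f a s = avg f s a := by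
  have h := intervalIntegral.integral_comp_sub_left (a := 0) (b := 1)
    (fun t => f (s + (a - s) * t)) 1
  simp only [sub_self, sub_zero] at h
  rw [avg, avg, ← h]
  congr 1
  ext t
  ring_nf

lemma sub_mul_avg_add {f : ℝ → ℝ} (hf : Continuous f) (a m s : ℝ) :
    (m - a) * avg f a m + (s - m) * avg f m s = (s - a) * avg f a s := by
  simp only [sub_mul_avg]
  exact intervalIntegral.integral_add_adjacent_intervals (hf.intervalIntegrable _ _)
    (hf.intervalIntegrable _ _)

/-- A point moving linearly along a segment in ℝ³ couples three uniform laws, so positivity along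
the segment can be averaged. -/
lemma avg_add_three_nonneg {f g h : ℝ → ℝ} (hf : Continuous f) (hg : Continuous g)
    (hh : Continuous h) (a a' b b' c c' : ℝ)
    (H : ∀ t, 0 ≤ t → t ≤ 1 →
      0 ≤ f (a + (a' - a) * t) + g (b + (b' - b) * t) + h (c + (c' - c) * t)) :
    0 ≤ avg f a a' + avg g b b' + avg h c c' := by
  unfold avg
  have h1 : IntervalIntegrable (fun t => f (a + (a' - a) * t)) volume 0 1 :=
    (hf.comp (by fun_prop)).intervalIntegrable _ _
  have h2 : IntervalIntegrable (fun t => g (b + (b' - b) * t)) volume 0 1 :=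
    (hg.comp (by fun_prop)).intervalIntegrable _ _
  have h3 : IntervalIntegrable (fun t => h (c + (c' - c) * t)) volume 0 1 :=
    (hh.comp (by fun_prop)).intervalIntegrable _ _
  rw [← intervalIntegral.integral_add h1 h2, ← intervalIntegral.integral_add (h1.add h2) h3]
  exact intervalIntegral.integral_nonneg zero_le_one fun t ht => H t ht.1 ht.2

/-- Three uniform distributions whose lengths satisfy the triangle inequality can be coupled with
constant sum: the dual form, for functions whose sum is nonnegative on the slice. -/
lemma avg_triangle_nonneg {f g h : ℝ → ℝ} (hf : Continuous f) (hg : Continuous g)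
    (hh : Continuous h) {x y z : ℝ} (hx : 0 ≤ x) (hy : 0 ≤ y) (hz : 0 ≤ z)
    (H : ∀ u v w, 0 ≤ u → u ≤ x + z → 0 ≤ v → v ≤ x + y → 0 ≤ w → w ≤ y + z →
      u + v + w = x + y + z → 0 ≤ f u + g v + h w) :
    0 ≤ avg f 0 (x + z) + avg g 0 (x + y) + avg h 0 (y + z) := by
  -- The slice contains the triangle with vertices (0, x+y, z), (x+z, y, 0), (x, 0, y+z). `hA`,
  -- `hB`, `hC` average along its edges; on each edge one coordinate sweeps its whole interval and
  -- the others sweep complementary parts of theirs.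
  have hA : 0 ≤ avg f 0 (x + z) + avg g (x + y) y + avg h z 0 := by
    refine avg_add_three_nonneg hf hg hh _ _ _ _ _ _ fun t h0 h1 => H _ _ _ ?_ ?_ ?_ ?_ ?_ ?_ ?_ <;>
    nlinarith
  have hB : 0 ≤ avg f x 0 + avg g 0 (x + y) + avg h (y + z) z := by
    refine avg_add_three_nonneg hf hg hh _ _ _ _ _ _ fun t h0 h1 => H _ _ _ ?_ ?_ ?_ ?_ ?_ ?_ ?_ <;>
    nlinarith
  have hC : 0 ≤ avg f (x + z) x + avg g y 0 + avg h 0 (y + z) := by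
    refine avg_add_three_nonneg hf hg hh _ _ _ _ _ _ fun t h0 h1 => H _ _ _ ?_ ?_ ?_ ?_ ?_ ?_ ?_ <;>
    nlinarith
  rw [avg_comm g, avg_comm h z] at hA
  rw [avg_comm f, avg_comm h _ z] at hB
  rw [avg_comm f, avg_comm g y] at hC
  have ef := sub_mul_avg_add hf 0 x (x + z)
  have eg := sub_mul_avg_add hg 0 y (x + y)
  have eh := sub_mul_avg_add hh 0 z (y + z)
  have hxy := mul_nonneg hx hy
  have hyz := mul_nonneg hy hz
  have hxz := mul_nonneg hx hz
  -- Edge weights x z, x y, y z make the two partial averages of each function recombine into the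
  -- full one. They all vanish only when two of x, y, z are zero, and then a single edge suffices.
  rcases (by positivity : 0 ≤ x * y + y * z + x * z).eq_or_lt with h0 | hpos
  · have h1 : x * y = 0 := by linarith
    have h2 : y * z = 0 := by linarith
    have h3 : x * z = 0 := by linarith
    rcases mul_eq_zero.1 h1 with rfl | rfl
    · rcases mul_eq_zero.1 h2 with rfl | rfl
      · simpa using hC
      · simpa using hB
    · rcases mul_eq_zero.1 h3 with rfl | rfl
      · simpa using hC
      · simpa using hA
  · refine nonneg_of_mul_nonneg_right ?_ hpos
    have : 0 ≤ x * z * (avg f 0 (x + z) + avg g y (x + y) + avg h 0 z)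
      + x * y * (avg f 0 x + avg g 0 (x + y) + avg h z (y + z))
      + y * z * (avg f x (x + z) + avg g 0 y + avg h 0 (y + z)) := by positivity
    refine this.trans_eq ?_
    linear_combination y * ef + z * eg + x * eh

/-- Groupwise comonotone combination. -/
lemma avg_sum_group {n : ℕ} (f : Fin n → ℝ → ℝ) (hf : ∀ i, Continuous (f i)) (α ℓ : Fin n → ℝ)
    (hℓ : ∀ i, 0 ≤ ℓ i) (s : Finset (Fin n)) :
    avg (fun u => ∑ i ∈ s, f i (α i + ℓ i * (u / ∑ j ∈ s, ℓ j))) 0 (∑ j ∈ s, ℓ j)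
      = ∑ i ∈ s, avg (f i) (α i) (α i + ℓ i) := by
  unfold avg
  rw [← intervalIntegral.integral_finsetSum]
  · congr 1
    ext t
    refine Finset.sum_congr rfl fun i hi => ?_
    congr 1
    rcases eq_or_ne (∑ j ∈ s, ℓ j) 0 with h0 | h0
    · have := (Finset.sum_eq_zero_iff_of_nonneg fun j _ => hℓ j).1 h0 i hi
      simp [this]
    · field_simp
      ring
  · intro i _
    exact ((hf i).comp (by fun_prop)).intervalIntegrable _ _

/-- Uniform distributions whose lengths satisfy the polygon inequality can be coupled with constant
sum: the dual form. -/
lemma avg_polygon_nonneg {n : ℕ} (f : Fin n → ℝ → ℝ) (hf : ∀ i, Continuous (f i))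
    (α ℓ : Fin n → ℝ) (L : ℝ) (hℓ : ∀ i, 0 ≤ ℓ i) (hL : ∀ i, ℓ i ≤ L) (hsum : ∑ i, ℓ i = 2 * L)
    (H : ∀ x : Fin n → ℝ, (∀ i, α i ≤ x i) → (∀ i, x i ≤ α i + ℓ i) → ∑ i, x i = ∑ i, α i + L →
      0 ≤ ∑ i, f i (x i)) :
    0 ≤ ∑ i, avg (f i) (α i) (α i + ℓ i) := by
  rcases Nat.eq_zero_or_pos n with rfl | hn
  · simp
  have hL0 : 0 ≤ L := (hℓ ⟨0, hn⟩).trans (hL _)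
  -- A median index: the lengths before, at and after `j` form three groups of total at most L each,
  -- hence satisfying the triangle inequality since all sum to 2L. Within a group the coordinates
  -- move comonotonically.
  obtain ⟨j, hj1, hj2⟩ : ∃ j : Fin n, ∑ i with i < j, ℓ i ≤ L ∧ ∑ i with j < i, ℓ i ≤ L := by
    let S : Finset (Fin n) := {j | ∑ i with i < j, ℓ i ≤ L}
    have hS : S.Nonempty := by
      refine ⟨⟨0, hn⟩, ?_⟩
      have : (Finset.univ.filter fun i : Fin n => i < ⟨0, hn⟩) = ∅ := by
        ext i; simp [Fin.lt_def]
      simp only [S, Finset.mem_filter, Finset.mem_univ, true_and]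
      rw [this]; simpa using hL0
    refine ⟨S.max' hS, (Finset.mem_filter.1 (S.max'_mem hS)).2, ?_⟩
    set j := S.max' hS with hj
    by_contra! hlt
    have h1 : ∑ i with i ≤ j, ℓ i < L := by
      have := Finset.sum_filter_add_sum_filter_not Finset.univ (fun i => i ≤ j) ℓ
      simp only [not_le] at this
      linarith
    obtain ⟨k, hk⟩ : ∃ k : Fin n, j < k := by
      by_contra! hno
      have : (Finset.univ.filter fun i : Fin n => j < i) = ∅ := by
        ext i; simpa using hno i
      rw [this] at hlt
      simp at hlt
      linarith
    have hjn : j.1 + 1 < n := by have := Fin.lt_def.1 hk; omega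
    have hmem : (⟨j.1 + 1, hjn⟩ : Fin n) ∈ S := by
      simp only [S, Finset.mem_filter, Finset.mem_univ, true_and]
      have : (Finset.univ.filter fun i : Fin n => i < ⟨j.1 + 1, hjn⟩)
          = Finset.univ.filter fun i => i ≤ j := by
        ext i
        simp only [Finset.mem_filter, Finset.mem_univ, true_and, Fin.lt_def, Fin.le_def]
        omega
      rw [this]; exact h1.le
    have : (⟨j.1 + 1, hjn⟩ : Fin n) ≤ j := S.le_max' _ hmem
    simp [Fin.le_def] at this
  have key : ∀ F : Fin n → ℝ, ∑ i, F i
      = ∑ i with i < j, F i + ∑ i ∈ {j}, F i + ∑ i with j < i, F i := by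
    intro F
    have h1 := Finset.sum_filter_add_sum_filter_not Finset.univ (fun i => i ≤ j) F
    have h2 : (Finset.univ.filter fun i => i ≤ j)
        = (Finset.univ.filter fun i => i < j) ∪ {j} := by
      ext i; simp [le_iff_lt_or_eq, or_comm]
    rw [h2, Finset.sum_union (by simp)] at h1
    simp only [not_le] at h1
    exact h1.symm
  set A := Finset.univ.filter fun i => i < j with hA
  set C := Finset.univ.filter fun i => j < i with hC
  set B : Finset (Fin n) := {j} with hB
  set a := ∑ i ∈ A, ℓ i with ha
  set b := ∑ i ∈ B, ℓ i with hb
  set c := ∑ i ∈ C, ℓ i with hc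
  have hbL : b ≤ L := by rw [hb, hB, Finset.sum_singleton]; exact hL j
  have habc : a + b + c = 2 * L := by rw [← hsum, key ℓ]
  rw [key, ← avg_sum_group f hf α ℓ hℓ A, ← avg_sum_group f hf α ℓ hℓ B,
    ← avg_sum_group f hf α ℓ hℓ C, ← ha, ← hb, ← hc]
  have hcont : ∀ (s : Finset (Fin n)) (r : ℝ),
      Continuous fun u => ∑ i ∈ s, f i (α i + ℓ i * (u / r)) := fun s r =>
    continuous_finsetSum _ fun i _ => (hf i).comp (by fun_prop)
  have ea : a = (L - c) + (L - b) := by linarith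
  have eb : b = (L - c) + (L - a) := by linarith
  have ec : c = (L - a) + (L - b) := by linarith
  have T := avg_triangle_nonneg (hcont A a) (hcont B b) (hcont C c) (x := L - c) (y := L - a)
    (z := L - b) (by linarith) (by linarith) (by linarith)
  rw [← ea, ← eb, ← ec] at T
  refine T fun u v w hu hua hv hvb hw hwc huvw => ?_
  let r : Fin n → ℝ := fun i => if i < j then u / a else if i = j then v / b else w / c
  have rA : ∀ i ∈ A, r i = u / a := fun i hi => if_pos (Finset.mem_filter.1 hi).2
  have rB : ∀ i ∈ B, r i = v / b := fun i hi => by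
    have := Finset.mem_singleton.1 hi
    simp [r, this]
  have rC : ∀ i ∈ C, r i = w / c := fun i hi => by
    have h : j < i := (Finset.mem_filter.1 hi).2
    simp [r, h.not_gt, h.ne']
  have r0 : ∀ i, 0 ≤ r i := fun i => by
    have ha0 : 0 ≤ a := hu.trans hua
    have hb0 : 0 ≤ b := hv.trans hvb
    have hc0 : 0 ≤ c := hw.trans hwc
    simp only [r]; split_ifs <;> positivity
  have r1 : ∀ i, r i ≤ 1 := fun i => by
    simp only [r]
    split_ifs
    exacts [div_le_one_of_le₀ hua (hu.trans hua), div_le_one_of_le₀ hvb (hv.trans hvb),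
      div_le_one_of_le₀ hwc (hw.trans hwc)]
  have hx := H (fun i => α i + ℓ i * r i) (fun i => by nlinarith [hℓ i, r0 i])
    (fun i => by nlinarith [hℓ i, r1 i]) ?_
  · rw [key] at hx
    convert hx using 2
    · congr 1
      · exact Finset.sum_congr rfl fun i hi => by rw [rA i hi]
      · exact Finset.sum_congr rfl fun i hi => by rw [rB i hi]
    · exact Finset.sum_congr rfl fun i hi => by rw [rC i hi]
  · have hdiv : ∀ p q : ℝ, 0 ≤ p → p ≤ q → q * (p / q) = p := fun p q hp hpq => by
      rcases eq_or_ne q 0 with rfl | hq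
      · simp; linarith
      · field_simp
    have e : ∑ i, ℓ i * r i = u + v + w := by
      rw [key, Finset.sum_congr (s₁ := A) rfl fun i hi => by rw [rA i hi],
        Finset.sum_congr (s₁ := B) rfl fun i hi => by rw [rB i hi],
        Finset.sum_congr (s₁ := C) rfl fun i hi => by rw [rC i hi],
        ← Finset.sum_mul, ← Finset.sum_mul, ← Finset.sum_mul, ← ha, ← hb, ← hc,
        hdiv u a hu hua, hdiv v b hv hvb, hdiv w c hw hwc]
    rw [Finset.sum_add_distrib, e]
    linarith

/-! ### Lagrange multiplier and the dual inequality for mixtures -/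

/-- Minimality is a closed condition on the pair (c, s), and projecting away the compact cube of
candidates s is a closed map. -/
lemma isClosed_setOf_exists_minimizer {n : ℕ} {T : ℝ} {F : Fin n → ℝ → ℝ}
    (hF : ∀ i, Continuous (F i)) {P : Set (Fin n → ℝ)} (hP : IsClosed P) :
    IsClosed {c : ℝ | ∃ s ∈ Set.Icc (0 : Fin n → ℝ) (fun _ => T),
      (∀ i, ∀ t ∈ Set.Icc 0 T, F i (s i) - c * s i ≤ F i t - c * t) ∧ s ∈ P} := by
  have : CompactSpace (Set.Icc (0 : Fin n → ℝ) (fun _ => T)) :=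
    isCompact_iff_compactSpace.1 isCompact_Icc
  let E : Set (ℝ × Set.Icc (0 : Fin n → ℝ) (fun _ => T)) :=
    {z | (∀ i, ∀ t ∈ Set.Icc 0 T, F i (z.2.1 i) - z.1 * z.2.1 i ≤ F i t - z.1 * t) ∧ z.2.1 ∈ P}
  have hE : IsClosed E := by
    have hc : ∀ i, Continuous fun z : ℝ × Set.Icc (0 : Fin n → ℝ) (fun _ => T) => z.2.1 i :=
      fun i => (continuous_apply i).comp (continuous_subtype_val.comp continuous_snd)
    refine IsClosed.and ?_ (hP.preimage (continuous_subtype_val.comp continuous_snd))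
    simp only [Set.ofPred_forall]
    exact isClosed_iInter fun i => isClosed_iInter fun t => isClosed_iInter fun _ =>
      isClosed_le (((hF i).comp (hc i)).sub (continuous_fst.mul (hc i))) (by fun_prop)
  convert isClosedMap_fst_of_compactSpace _ hE using 1
  ext c
  simp only [Set.mem_ofPred_eq, Set.mem_image, E, Prod.exists, Subtype.exists]
  constructor
  · rintro ⟨s, hs, h⟩
    exact ⟨c, s, hs, h, rfl⟩
  · rintro ⟨_, s, hs, h, rfl⟩
    exact ⟨s, hs, h⟩

/-- A Lagrange multiplier `c` such that `F i - c * ·` has minimizers on `[0, T]` with sum in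
`[T, 2 T]`. -/
lemma exists_multiplier {n : ℕ} (hn : 2 ≤ n) {T : ℝ} (hT : 0 < T) {F : Fin n → ℝ → ℝ}
    (hF : ∀ i, Continuous (F i)) :
    ∃ (c : ℝ) (s : Fin n → ℝ), (∀ i, 0 ≤ s i) ∧ (∀ i, s i ≤ T) ∧
      (∀ i, ∀ t ∈ Set.Icc 0 T, F i (s i) - c * s i ≤ F i t - c * t) ∧
      T ≤ ∑ i, s i ∧ ∑ i, s i ≤ 2 * T := by
  let low : Set ℝ := {c | ∃ s ∈ Set.Icc (0 : Fin n → ℝ) (fun _ => T),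
      (∀ i, ∀ t ∈ Set.Icc 0 T, F i (s i) - c * s i ≤ F i t - c * t) ∧ s ∈ {s | ∑ i, s i ≤ 2 * T}}
  let high : Set ℝ := {c | ∃ s ∈ Set.Icc (0 : Fin n → ℝ) (fun _ => T),
      (∀ i, ∀ t ∈ Set.Icc 0 T, F i (s i) - c * s i ≤ F i t - c * t) ∧ s ∈ {s | T ≤ ∑ i, s i}}
  have hlow : IsClosed low :=
    isClosed_setOf_exists_minimizer hF (isClosed_le (by fun_prop) (by fun_prop))
  have hhigh : IsClosed high :=
    isClosed_setOf_exists_minimizer hF (isClosed_le (by fun_prop) (by fun_prop))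
  have hmin : ∀ c : ℝ, ∃ s ∈ Set.Icc (0 : Fin n → ℝ) (fun _ => T),
      ∀ i, ∀ t ∈ Set.Icc 0 T, F i (s i) - c * s i ≤ F i t - c * t := by
    intro c
    have h : ∀ i, ∃ x ∈ Set.Icc 0 T, IsMinOn (fun t => F i t - c * t) (Set.Icc 0 T) x := fun i =>
      isCompact_Icc.exists_isMinOn (Set.nonempty_Icc.2 hT.le)
        (Continuous.continuousOn (by fun_prop))
    choose s hs hs' using h
    exact ⟨s, ⟨fun i => (hs i).1, fun i => (hs i).2⟩, fun i t ht => hs' i ht⟩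
  obtain ⟨B, hB, hFB⟩ : ∃ B : ℝ, 0 < B ∧ ∀ i, ∀ t ∈ Set.Icc 0 T, |F i t| ≤ B := by
    have h : ∀ i, ∃ b, ∀ t ∈ Set.Icc 0 T, ‖F i t‖ ≤ b := fun i =>
      isCompact_Icc.exists_bound_of_continuousOn (hF i).continuousOn
    choose b hb using h
    refine ⟨1 + ∑ i, |b i|, by positivity, fun i t ht => ?_⟩
    have h1 := Finset.single_le_sum (f := fun i => |b i|) (fun i _ => abs_nonneg _)
      (Finset.mem_univ i)
    have h2 := (hb i t ht).trans (le_abs_self _)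
    rw [Real.norm_eq_abs] at h2
    linarith
  have hn0 : (0 : ℝ) < n := by positivity
  have hn2 : (2 : ℝ) ≤ n := by exact_mod_cast hn
  -- Chosen so that 2B / c₀ = T / n: for -c₀ all minimizers are at most T / n, and for c₀ at least T
  -- - T / n, with total at least (n - 1) T ≥ T because n ≥ 2.
  set c₀ := 2 * B * n / T with hc₀
  have hc₀pos : 0 < c₀ := by positivity
  have hc₀T : 2 * B / c₀ * n = T := by rw [hc₀]; field_simp
  have hlow' : -c₀ ∈ low := by
    obtain ⟨s, hs, hs'⟩ := hmin (-c₀)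
    refine ⟨s, hs, hs', ?_⟩
    have : ∀ i, s i ≤ 2 * B / c₀ := fun i => by
      have h0 := hs' i 0 ⟨le_rfl, hT.le⟩
      have h1 := abs_le.1 (hFB i 0 ⟨le_rfl, hT.le⟩)
      have h2 := abs_le.1 (hFB i (s i) ⟨hs.1 i, hs.2 i⟩)
      rw [le_div_iff₀ hc₀pos]
      linarith
    have := Finset.sum_le_sum fun i (_ : i ∈ Finset.univ) => this i
    simp only [Finset.sum_const, Finset.card_univ, Fintype.card_fin, nsmul_eq_mul] at this
    simp only [Set.mem_ofPred_eq]
    linarith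
  have hhigh' : c₀ ∈ high := by
    obtain ⟨s, hs, hs'⟩ := hmin c₀
    refine ⟨s, hs, hs', ?_⟩
    have : ∀ i, T - 2 * B / c₀ ≤ s i := fun i => by
      have h0 := hs' i T ⟨hT.le, le_rfl⟩
      have h1 := abs_le.1 (hFB i T ⟨hT.le, le_rfl⟩)
      have h2 := abs_le.1 (hFB i (s i) ⟨hs.1 i, hs.2 i⟩)
      rw [sub_le_comm, le_div_iff₀ hc₀pos]
      linarith
    have := Finset.sum_le_sum fun i (_ : i ∈ Finset.univ) => this i
    simp only [Finset.sum_const, Finset.card_univ, Fintype.card_fin, nsmul_eq_mul] at this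
    simp only [Set.mem_ofPred_eq]
    nlinarith
  -- Minimizers need not be unique or depend continuously on c; connectedness of ℝ instead yields
  -- one c having a minimizer of low sum and one of high sum.
  obtain ⟨c, -, ⟨s, hs, hsm, hsT⟩, s', hs', hsm', hsT'⟩ :=
    isPreconnected_closed_iff.1 (isPreconnected_univ (α := ℝ)) low high hlow hhigh
      (fun c _ => by
        obtain ⟨s, hs, hs'⟩ := hmin c
        rcases le_total T (∑ i, s i) with h | h
        · exact Or.inr ⟨s, hs, hs', h⟩
        · exact Or.inl ⟨s, hs, hs', by simp only [Set.mem_ofPred_eq]; linarith⟩)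
      ⟨_, trivial, hlow'⟩ ⟨_, trivial, hhigh'⟩
  simp only [Set.mem_ofPred_eq] at hsT hsT'
  refine ⟨c, ?_⟩
  by_contra! hno
  -- Replacing `s` by `s'` one coordinate at a time preserves minimality and raises the sum by at
  -- most T per step, so it cannot jump over the window [T, 2T].
  have hwalk : ∀ A : Finset (Fin n), ∑ i, A.piecewise s' s i < T := by
    intro A
    induction A using Finset.induction_on with
    | empty =>
      by_contra! h
      simp only [Finset.piecewise_empty] at h
      exact (hno s hs.1 hs.2 hsm h).not_ge hsT
    | insert a A ha ih =>
      by_contra! h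
      refine (hno ((insert a A).piecewise s' s) ?_ ?_ ?_ h).not_ge ?_
      · intro i
        by_cases hi : i ∈ insert a A
        · rw [Finset.piecewise_eq_of_mem _ _ _ hi]; exact hs'.1 i
        · rw [Finset.piecewise_eq_of_notMem _ _ _ hi]; exact hs.1 i
      · intro i
        by_cases hi : i ∈ insert a A
        · rw [Finset.piecewise_eq_of_mem _ _ _ hi]; exact hs'.2 i
        · rw [Finset.piecewise_eq_of_notMem _ _ _ hi]; exact hs.2 i
      · intro i
        by_cases hi : i ∈ insert a A
        · rw [Finset.piecewise_eq_of_mem _ _ _ hi]; exact hsm' i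
        · rw [Finset.piecewise_eq_of_notMem _ _ _ hi]; exact hsm i
      · rw [Finset.piecewise_insert, Finset.sum_update_of_mem (Finset.mem_univ a)]
        have h1 := Finset.add_sum_erase Finset.univ (A.piecewise s' s) (Finset.mem_univ a)
        rw [Finset.sdiff_singleton_eq_erase]
        rw [Finset.piecewise_eq_of_notMem _ _ _ ha] at h1
        have h2 := hs.1 a
        have h3 := hs'.2 a
        simp only [Pi.zero_apply] at h2
        linarith
  have := hwalk Finset.univ
  simp only [Finset.piecewise_univ] at this
  exact this.not_ge hsT'

/-- For F t = `avg f 0 t`, additivity gives (s - a) `avg f a s` = s F(s) - a F(a). Inserting F(a) ≥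
F(s) - c (s - a) and dividing by s - a gives the bound; a = s follows by continuity. -/
lemma avg_le_of_isMinOn {f : ℝ → ℝ} (hf : Continuous f) {a s c : ℝ} (ha : 0 ≤ a) (has : a ≤ s)
    (H : ∀ t ∈ Set.Icc 0 s, avg f 0 s - c * s ≤ avg f 0 t - c * t) :
    avg f a s ≤ avg f 0 s + c * a := by
  have key : ∀ b, 0 ≤ b → b < s → avg f b s ≤ avg f 0 s + c * b := by
    intro b hb hbs
    have h1 := sub_mul_avg_add hf 0 b s
    have h2 := mul_le_mul_of_nonneg_left (H b ⟨hb, hbs.le⟩) hb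
    refine le_of_mul_le_mul_left ?_ (sub_pos.2 hbs)
    simp only [sub_zero] at h1
    linarith
  rcases has.lt_or_eq with h | rfl
  · exact key a ha h
  rcases ha.eq_or_lt with rfl | ha
  · simp
  have hc : Continuous fun b => avg f b a :=
    (continuous_avg hf).comp (Continuous.prodMk continuous_id continuous_const)
  refine le_of_tendsto_of_tendsto (hc.continuousWithinAt (s := Set.Iio a) (x := a))
    ((by fun_prop : Continuous fun b => avg f 0 a + c * b).continuousWithinAt
      (s := Set.Iio a) (x := a)) ?_
  filter_upwards [Ioo_mem_nhdsLT ha] with b hb using key b hb.1.le hb.2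

/-- Truncate each s i at the excess L = ∑ s - T, then scale the truncations down to total 2L. -/
lemma exists_polygon_lengths {n : ℕ} {s : Fin n → ℝ} {T : ℝ} (hs : ∀ i, 0 ≤ s i)
    (hsT : ∀ i, s i ≤ T) (h1 : T ≤ ∑ i, s i) (h2 : ∑ i, s i ≤ 2 * T) :
    ∃ ℓ : Fin n → ℝ, (∀ i, 0 ≤ ℓ i) ∧ (∀ i, ℓ i ≤ s i) ∧ (∀ i, ℓ i ≤ ∑ i, s i - T) ∧
      ∑ i, ℓ i = 2 * (∑ i, s i - T) := by
  set L := ∑ i, s i - T with hL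
  have hL0 : 0 ≤ L := by linarith
  have hm : ∀ i, 0 ≤ min (s i) L := fun i => le_min (hs i) hL0
  -- Two entries reaching L suffice. With exactly one, the others sum to at least ∑ s - T = L. With
  -- none, the claim is ∑ s ≤ 2T.
  have hW : 2 * L ≤ ∑ i, min (s i) L := by
    by_cases hj : ∃ j, L ≤ s j
    · obtain ⟨j, hj⟩ := hj
      rw [← Finset.add_sum_erase _ _ (Finset.mem_univ j), min_eq_right hj, two_mul]
      gcongr
      by_cases hk : ∃ k ∈ Finset.univ.erase j, L ≤ s k
      · obtain ⟨k, hk, hkL⟩ := hk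
        calc L = min (s k) L := (min_eq_right hkL).symm
          _ ≤ _ := Finset.single_le_sum (f := fun i => min (s i) L) (fun i _ => hm i) hk
      · push Not at hk
        rw [Finset.sum_congr rfl fun i hi => min_eq_left (hk i hi).le]
        have := Finset.add_sum_erase _ s (Finset.mem_univ j)
        linarith [hsT j]
    · push Not at hj
      rw [Finset.sum_congr rfl fun i _ => min_eq_left (hj i).le]
      linarith
  rcases hL0.eq_or_lt with h0 | hpos
  · exact ⟨0, fun _ => le_rfl, hs, fun _ => hL0, by simp [← h0]⟩
  have hWpos : 0 < ∑ i, min (s i) L := by linarith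
  have hθ : 2 * L / ∑ i, min (s i) L ≤ 1 := (div_le_one hWpos).2 hW
  have hle : ∀ i, 2 * L / (∑ i, min (s i) L) * min (s i) L ≤ min (s i) L := fun i =>
    mul_le_of_le_one_left (hm i) hθ
  refine ⟨fun i => 2 * L / (∑ i, min (s i) L) * min (s i) L, fun i => ?_,
    fun i => (hle i).trans (min_le_left _ _), fun i => (hle i).trans (min_le_right _ _), ?_⟩
  · have := hm i
    positivity
  · rw [← Finset.mul_sum, div_mul_cancel₀ _ hWpos.ne']

/-- The dual form of the joint mixability of the laws `(1 - p i) δ₀ + p i Unif[0, h i]`. -/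
lemma sum_mixture_nonneg {n : ℕ} (hn : 2 ≤ n) {T : ℝ} (hT : 0 < T) {f : Fin n → ℝ → ℝ}
    (hf : ∀ i, Continuous (f i))
    (H : ∀ x : Fin n → ℝ, (∀ i, 0 ≤ x i) → ∑ i, x i = T → 0 ≤ ∑ i, f i (x i))
    {p h : Fin n → ℝ} (hp0 : ∀ i, 0 ≤ p i) (hp1 : ∀ i, p i ≤ 1) (hh0 : ∀ i, 0 ≤ h i)
    (hhT : ∀ i, h i ≤ T) (hsum : ∑ i, p i * h i = 2 * T) :
    0 ≤ ∑ i, ((1 - p i) * f i 0 + p i * avg (f i) 0 (h i)) := by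
  have hF : ∀ i, Continuous (avg (f i) 0) := fun i =>
    (continuous_avg (hf i)).comp (Continuous.prodMk continuous_const continuous_id)
  obtain ⟨c, s, hs0, hsT, hmin, hs1, hs2⟩ := exists_multiplier hn hT hF
  obtain ⟨ℓ, hℓ0, hℓs, hℓL, hℓ⟩ := exists_polygon_lengths hs0 hsT hs1 hs2
  -- The constant sum is ∑ (s i - ℓ i) + L with ∑ ℓ = 2L and L = ∑ s - T, which is exactly T.
  have h1 : 0 ≤ ∑ i, avg (f i) (s i - ℓ i) (s i - ℓ i + ℓ i) := by
    refine avg_polygon_nonneg f hf _ ℓ _ hℓ0 hℓL hℓ fun x hx _ hxs =>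
      H x (fun i => (sub_nonneg.2 (hℓs i)).trans (hx i)) ?_
    rw [hxs, Finset.sum_sub_distrib, hℓ]
    ring
  have h2 : ∑ i, avg (f i) (s i - ℓ i) (s i - ℓ i + ℓ i)
      ≤ ∑ i, (avg (f i) 0 (s i) + c * (s i - ℓ i)) := by
    refine Finset.sum_le_sum fun i _ => ?_
    rw [sub_add_cancel]
    exact avg_le_of_isMinOn (hf i) (sub_nonneg.2 (hℓs i)) (by linarith [hℓ0 i]) fun t ht =>
      hmin i t ⟨ht.1, ht.2.trans (hsT i)⟩
  have h3 : ∑ i, (avg (f i) 0 (s i) - c * s i + c * (p i * h i))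
      ≤ ∑ i, ((1 - p i) * f i 0 + p i * avg (f i) 0 (h i)) := by
    refine Finset.sum_le_sum fun i _ => ?_
    have h4 := mul_le_mul_of_nonneg_left (hmin i 0 ⟨le_rfl, hT.le⟩) (sub_nonneg.2 (hp1 i))
    have h5 := mul_le_mul_of_nonneg_left (hmin i (h i) ⟨hh0 i, hhT i⟩) (hp0 i)
    rw [avg_self] at h4
    linarith
  have h6 := h1.trans h2
  refine le_trans ?_ h3
  rw [Finset.sum_add_distrib, ← Finset.mul_sum, Finset.sum_sub_distrib, hℓ] at h6
  rw [Finset.sum_add_distrib, Finset.sum_sub_distrib, ← Finset.mul_sum, ← Finset.mul_sum, hsum]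
  linarith

/-! ### Integrals against uniform laws and mixtures -/

lemma isProbabilityMeasure_unif {b : ℝ} (hb : 0 < b) : IsProbabilityMeasure (unif b) := by
  refine cond_isProbabilityMeasure_of_finite ?_ ?_ <;> simp [hb]

lemma isProbabilityMeasure_mixture {p b : ℝ} (hp0 : 0 ≤ p) (hp1 : p ≤ 1) (hb : 0 < b) :
    IsProbabilityMeasure (mixture p b) := by
  have := isProbabilityMeasure_unif hb
  refine ⟨?_⟩
  simp only [mixture, Measure.coe_add, Measure.coe_smul, Pi.add_apply, Pi.smul_apply, measure_univ,
    smul_eq_mul, mul_one]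
  rw [← ENNReal.ofReal_add (by linarith) hp0]
  simp

lemma mixture_one (b : ℝ) : mixture 1 b = unif b := by simp [mixture]

lemma integral_unif {b : ℝ} (hb : 0 < b) (f : ℝ → ℝ) : ∫ x, f x ∂(unif b) = avg f 0 b := by
  have h := sub_mul_avg f 0 b
  rw [unif, ProbabilityTheory.cond, integral_smul_measure, integral_Icc_eq_integral_Ioc,
    ← intervalIntegral.integral_of_le hb.le, ← h]
  simp [hb.le]
  field_simp

lemma ae_unif (b : ℝ) : ∀ᵐ x ∂(unif b), x ∈ Set.Icc 0 b :=
  Measure.ae_smul_measure (ae_restrict_mem measurableSet_Icc) _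

lemma integral_mixture {p b : ℝ} (hp0 : 0 ≤ p) (hp1 : p ≤ 1) (hb : 0 < b) {f : ℝ → ℝ}
    (hf : Continuous f) : ∫ x, f x ∂(mixture p b) = (1 - p) * f 0 + p * avg f 0 b := by
  have := isProbabilityMeasure_unif hb
  have hi : Integrable f (unif b) := by
    obtain ⟨C, hC⟩ := isCompact_Icc.exists_bound_of_continuousOn (hf.continuousOn (s := Set.Icc 0 b))
    refine Integrable.of_bound hf.aestronglyMeasurable C ?_
    filter_upwards [ae_unif b] with x hx using hC x hx
  rw [mixture, integral_add_measure, integral_smul_measure, integral_smul_measure, integral_dirac,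
    integral_unif hb, ENNReal.toReal_ofReal (by linarith), ENNReal.toReal_ofReal hp0]
  · simp
  · exact (integrable_dirac (by simp)).smul_measure ENNReal.ofReal_ne_top
  · exact hi.smul_measure ENNReal.ofReal_ne_top

/-! ### Duality: couplings from positivity on separable functions -/

/-- The separable function `x ↦ ∑ i, f i (x i)` on a set of vectors. -/
noncomputable def separable {n : ℕ} (K : Set (Fin n → ℝ)) :
    (Fin n → BoundedContinuousFunction ℝ ℝ) →ₗ[ℝ] C(K, ℝ) where
  toFun f := ⟨fun x => ∑ i, f i (x.1 i), continuous_finsetSum _ fun i _ =>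
    (f i).continuous.comp ((continuous_apply i).comp continuous_subtype_val)⟩
  map_add' f g := by
    ext x
    simp [Finset.sum_add_distrib]
  map_smul' c f := by
    ext x
    simp [Finset.mul_sum]

lemma separable_apply {n : ℕ} {K : Set (Fin n → ℝ)} (f : Fin n → BoundedContinuousFunction ℝ ℝ)
    (x : K) : separable K f x = ∑ i, f i (x.1 i) := rfl

/-- A measure on a compact set `K` of vectors with prescribed marginals exists as soon as the
prescribed integrals are compatible with the positivity of separable functions on `K`. -/
lemma exists_coupling_of_nonneg {n : ℕ} (hn : 0 < n) {K : Set (Fin n → ℝ)} (hK : IsCompact K)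
    (m : Fin n → Measure ℝ) [∀ i, IsProbabilityMeasure (m i)]
    (H : ∀ f : Fin n → BoundedContinuousFunction ℝ ℝ, (∀ x ∈ K, 0 ≤ ∑ i, f i (x i)) →
      0 ≤ ∑ i, ∫ x, f i x ∂(m i)) :
    ∃ μ : Measure (Fin n → ℝ), IsProbabilityMeasure μ ∧ IsCoupling m μ ∧ ∀ᵐ x ∂μ, x ∈ K := by
  have : CompactSpace K := isCompact_iff_compactSpace.1 hK
  -- Working with pairs (f, g) and the cone g + ∑ f i ≥ 0 avoids having to check that the sum of
  -- integrals depends only on the separable function, not on its decomposition.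
  let s : PointedCone ℝ ((Fin n → BoundedContinuousFunction ℝ ℝ) × C(K, ℝ)) :=
    { carrier := {z | ∀ x, 0 ≤ (z.2 + separable K z.1) x}
      add_mem' := by
        intro a b ha hb x
        rw [Prod.fst_add, Prod.snd_add, map_add, add_add_add_comm]
        exact add_nonneg (ha x) (hb x)
      zero_mem' := by intro x; simp
      smul_mem' := by
        rintro ⟨c, hc⟩ a ha x
        rw [Nonneg.mk_smul, Prod.smul_fst, Prod.smul_snd, map_smul, ← smul_add]
        exact mul_nonneg hc (ha x) }
  have hint : ∀ i (f : BoundedContinuousFunction ℝ ℝ), Integrable f (m i) := fun i f =>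
    f.integrable (m i)
  let I : (Fin n → BoundedContinuousFunction ℝ ℝ) →ₗ[ℝ] ℝ :=
    { toFun := fun f => ∑ i, ∫ x, f i x ∂(m i)
      map_add' := fun f g => by
        rw [← Finset.sum_add_distrib]
        exact Finset.sum_congr rfl fun i _ => integral_add (hint i _) (hint i _)
      map_smul' := fun c f => by
        rw [RingHom.id_apply, smul_eq_mul, Finset.mul_sum]
        exact Finset.sum_congr rfl fun i _ => integral_const_mul _ _ }
  let φ : ((Fin n → BoundedContinuousFunction ℝ ℝ) × C(K, ℝ)) →ₗ.[ℝ] ℝ :=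
    { domain := Submodule.prod ⊤ ⊥
      toFun := I.comp ((LinearMap.fst ℝ _ C(K, ℝ)).comp (Submodule.subtype _)) }
  obtain ⟨Λ, hΛ, hΛ0⟩ := riesz_extension s φ
    (by
      rintro ⟨⟨f, g⟩, hfg⟩ hmem
      have hg : g = 0 := (Submodule.mem_prod.1 hfg).2
      subst hg
      refine H f fun x hx => ?_
      have := hmem ⟨x, hx⟩
      rwa [zero_add] at this)
    (by
      rintro ⟨f, g⟩
      obtain ⟨C, hC⟩ := (isCompact_univ (X := K)).exists_bound_of_continuousOn
        (g + separable K f).continuous.continuousOn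
      refine ⟨⟨(Pi.single ⟨0, hn⟩ (BoundedContinuousFunction.const ℝ C), 0),
        Submodule.mem_prod.2 ⟨trivial, rfl⟩⟩, fun x => ?_⟩
      have h1 := neg_le_of_abs_le (hC x trivial)
      have h2 : separable K (Pi.single ⟨0, hn⟩ (BoundedContinuousFunction.const ℝ C)) x = C := by
        rw [separable_apply, Finset.sum_eq_single ⟨0, hn⟩ (by intro j _ hj; simp [hj]) (by simp)]
        simp
      simp only [Prod.mk_add_mk, zero_add, map_add, ContinuousMap.add_apply, h2] at h1 ⊢
      linarith)
  -- Both (f, -∑ f i) and its negative lie in the cone, so the positive extension vanishes there.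
  have hsep : ∀ f, Λ (0, separable K f) = ∑ i, ∫ x, f i x ∂(m i) := by
    intro f
    have h1 := hΛ0 (f, -separable K f) fun x => by simp
    have h2 := hΛ0 (-f, separable K f) fun x => by simp
    have h3 := hΛ ⟨(f, 0), Submodule.mem_prod.2 ⟨trivial, rfl⟩⟩
    have e1 : (f, -separable K f) = (f, 0) - (0, separable K f) := by simp
    have e2 : (-f, separable K f) = (0, separable K f) - (f, 0) := by simp
    rw [e1, map_sub] at h1
    rw [e2, map_sub] at h2
    have h4 : Λ (0, separable K f) = Λ (f, 0) := by linarith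
    rw [h4]
    exact h3
  let Λ' : CompactlySupportedContinuousMap K ℝ →ₗ[ℝ] ℝ :=
    { toFun := fun f => Λ (0, f.toContinuousMap)
      map_add' := fun f g => by
        rw [← map_add]
        congr 1
        ext <;> simp
      map_smul' := fun c f => by
        rw [RingHom.id_apply, ← map_smul]
        congr 1
        ext <;> simp }
  let Λp := PositiveLinearMap.mk₀ Λ' fun f hf => hΛ0 _ fun x => by
    have := hf x
    simpa using this
  let π := RealRMK.rieszMeasure Λp
  have hπ : ∀ i, (π.map Subtype.val).map (fun x => x i) = m i := by
    intro i
    rw [Measure.map_map (measurable_pi_apply i) measurable_subtype_coe]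
    refine ext_of_forall_integral_eq_of_IsFiniteMeasure fun f => ?_
    have hm : Measurable fun x : K => x.1 i := (measurable_pi_apply i).comp measurable_subtype_coe
    refine (integral_map (φ := fun x : K => x.1 i) hm.aemeasurable
      f.continuous.aestronglyMeasurable).trans ?_
    have h1 := RealRMK.integral_rieszMeasure Λp
      (CompactlySupportedContinuousMap.continuousMapEquiv (separable K (Pi.single i f)))
    have h2 := hsep (Pi.single i f)
    rw [Finset.sum_eq_single i (by intro j _ hj; simp [hj]) (by simp), Pi.single_eq_same] at h2
    rw [← h2, ← show _ = Λ (0, separable K (Pi.single i f)) from h1]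
    refine integral_congr_ae (Filter.Eventually.of_forall fun x => ?_)
    change f (x.1 i) = separable K (Pi.single i f) x
    rw [separable_apply, Finset.sum_eq_single i (by intro j _ hj; simp [hj]) (by simp),
      Pi.single_eq_same]
  refine ⟨π.map Subtype.val, ⟨?_⟩, hπ, ?_⟩
  · have h := congrArg (fun μ => μ Set.univ) (hπ ⟨0, hn⟩)
    simp only [measure_univ] at h
    rw [Measure.map_apply (measurable_pi_apply _) MeasurableSet.univ] at h
    simpa using h
  · refine (ae_map_iff (p := fun x => x ∈ K) measurable_subtype_coe.aemeasurable
      hK.measurableSet).2 ?_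
    exact Filter.Eventually.of_forall fun x => x.2

/-- Joint mixability of the laws `(1 - p i) δ₀ + p i Unif[0, h i]`. -/
theorem exists_coupling_mixture {n : ℕ} (hn : 2 ≤ n) {T : ℝ} (hT : 0 < T) {p h : Fin n → ℝ}
    (hp0 : ∀ i, 0 ≤ p i) (hp1 : ∀ i, p i ≤ 1) (hh0 : ∀ i, 0 < h i)
    (hhT : ∀ i, h i ≤ T) (hsum : ∑ i, p i * h i = 2 * T) :
    ∃ μ : Measure (Fin n → ℝ), IsCoupling (fun i => mixture (p i) (h i)) μ ∧ IsAdmissible T μ := by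
  have := fun i => isProbabilityMeasure_mixture (hp0 i) (hp1 i) (hh0 i)
  have hK : IsCompact {x : Fin n → ℝ | (∀ i, 0 ≤ x i) ∧ ∑ i, x i = T} := by
    refine (isCompact_Icc (a := (0 : Fin n → ℝ)) (b := fun _ => T)).of_isClosed_subset ?_ ?_
    · refine IsClosed.and ?_ (isClosed_eq (by fun_prop) (by fun_prop))
      simp only [Set.ofPred_forall]
      exact isClosed_iInter fun i => isClosed_le (by fun_prop) (by fun_prop)
    · rintro x ⟨hx, hxT⟩
      exact ⟨hx, fun i => hxT ▸ Finset.single_le_sum (fun i _ => hx i) (Finset.mem_univ i)⟩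
  obtain ⟨μ, hμ, hc, hae⟩ := exists_coupling_of_nonneg (by omega) hK
    (fun i => mixture (p i) (h i)) fun f hf => by
      simp only [integral_mixture (hp0 _) (hp1 _) (hh0 _) (f _).continuous]
      exact sum_mixture_nonneg hn hT (fun i => (f i).continuous) (fun x hx hxT => hf x ⟨hx, hxT⟩)
        hp0 hp1 (fun i => (hh0 i).le) hhT hsum
  exact ⟨μ, hc, hμ, hae.mono fun x hx => hx.1, hae.mono fun x hx => hx.2.le⟩

/-! ### Distribution functions and the affine payoff bound -/

variable {n : ℕ}

lemma unif_real_apply {b : ℝ} (hb : 0 < b) (s : Set ℝ) :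
    (unif b).real s = b⁻¹ * volume.real (Set.Icc 0 b ∩ s) := by
  rw [unif, measureReal_def, cond_apply measurableSet_Icc, ENNReal.toReal_mul, measureReal_def]
  simp [hb.le]

lemma unif_real_Iic_le {b x : ℝ} (hb : 0 < b) (hx : 0 ≤ x) :
    (unif b).real (Set.Iic x) ≤ x / b := by
  rw [unif_real_apply hb, div_eq_inv_mul]
  gcongr
  calc volume.real (Set.Icc 0 b ∩ Set.Iic x) ≤ volume.real (Set.Icc 0 x) :=
        measureReal_mono (fun y hy => ⟨hy.1.1, hy.2⟩) (by simp)
    _ = x := by simp [hx]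

lemma unif_real_Iio {b x : ℝ} (hb : 0 < b) (hx : 0 ≤ x) (hxb : x ≤ b) :
    (unif b).real (Set.Iio x) = x / b := by
  have : Set.Icc 0 b ∩ Set.Iio x = Set.Ico 0 x := by
    ext y
    simp only [Set.mem_inter_iff, Set.mem_Icc, Set.mem_Iio, Set.mem_Ico]
    constructor
    · rintro ⟨⟨h1, h2⟩, h3⟩
      exact ⟨h1, h3⟩
    · rintro ⟨h1, h2⟩
      exact ⟨⟨h1, h2.le.trans hxb⟩, h2⟩
  rw [unif_real_apply hb, this, div_eq_inv_mul]
  simp [hx]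

lemma mixture_real_apply {p b : ℝ} (hp0 : 0 ≤ p) (hp1 : p ≤ 1) (hb : 0 < b) (s : Set ℝ) :
    (mixture p b).real s = (1 - p) * (Measure.dirac 0 : Measure ℝ).real s + p * (unif b).real s := by
  have := isProbabilityMeasure_unif hb
  rw [mixture, measureReal_add_apply (ENNReal.mul_ne_top ENNReal.ofReal_ne_top (measure_ne_top _ _))
    (ENNReal.mul_ne_top ENNReal.ofReal_ne_top (measure_ne_top _ _)),
    measureReal_ennreal_smul_apply, measureReal_ennreal_smul_apply,
    ENNReal.toReal_ofReal (by linarith), ENNReal.toReal_ofReal hp0]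

lemma mixture_real_Iic_le {p b x : ℝ} (hp0 : 0 ≤ p) (hp1 : p ≤ 1) (hb : 0 < b) (hx : 0 ≤ x) :
    (mixture p b).real (Set.Iic x) ≤ 1 - p + p * (x / b) := by
  rw [mixture_real_apply hp0 hp1 hb]
  have h1 := mul_le_mul_of_nonneg_left (unif_real_Iic_le hb hx) hp0
  have h2 : (Measure.dirac 0 : Measure ℝ).real (Set.Iic x) ≤ 1 := measureReal_le_one
  nlinarith

/-- The final hypothesis excludes an atom of the opponent at 0 meeting x = 0, where a strict win
would miss the mass 1 - p. -/
lemma le_mixture_real_Iio {p b x : ℝ} (hp0 : 0 ≤ p) (hp1 : p ≤ 1) (hb : 0 < b) (hx : 0 ≤ x)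
    (hxb : x ≤ b) (h : p = 1 ∨ 0 < x) :
    1 - p + p * (x / b) ≤ (mixture p b).real (Set.Iio x) := by
  rw [mixture_real_apply hp0 hp1 hb, unif_real_Iio hb hx hxb]
  rcases h with rfl | h
  · simp
  · simp [Measure.real, h]

lemma ae_mixture_mem_Icc {p b : ℝ} (hb : 0 < b) : ∀ᵐ x ∂(mixture p b), x ∈ Set.Icc 0 b := by
  rw [mixture, ae_add_measure_iff]
  refine ⟨Measure.ae_smul_measure ?_ _, Measure.ae_smul_measure (ae_unif b) _⟩
  refine (ae_dirac_iff (p := fun x => x ∈ Set.Icc 0 b) measurableSet_Icc).2 ?_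
  exact ⟨le_rfl, hb.le⟩

lemma ae_unif_pos (b : ℝ) : ∀ᵐ x ∂(unif b), 0 < x := by
  have h : ∀ᵐ x ∂(unif b), x ≠ 0 :=
    Measure.ae_smul_measure (ae_restrict_of_ae (Measure.ae_ne volume 0)) _
  filter_upwards [ae_unif b, h] with x hx h0 using lt_of_le_of_ne hx.1 (Ne.symm h0)

lemma avg_id (b : ℝ) : avg id 0 b = b / 2 := by
  simp only [avg, id, zero_add, sub_zero]
  rw [intervalIntegral.integral_const_mul, integral_id]
  ring

/-- The expected reward of a player facing the marginals `mixture (q i) (h i)` is at most affine in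
her budget, with equality for the marginals `mixture (p i) (h i)`. -/
lemma expected_le_of_lotto {v p q h : Fin n → ℝ} {κ T : ℝ} (hκ : 0 ≤ κ) (hv : ∀ i, 0 ≤ v i)
    (hp0 : ∀ i, 0 ≤ p i) (hp1 : ∀ i, p i ≤ 1) (hq0 : ∀ i, 0 ≤ q i) (hq1 : ∀ i, q i ≤ 1)
    (hpq : ∀ i, p i = 1 ∨ q i = 1) (hh : ∀ i, 0 < h i) (hvκ : ∀ i, v i * q i = κ * h i)
    (hsum : ∑ i, p i * h i = 2 * T) {μ μ' ν : Measure (Fin n → ℝ)}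
    (hμc : IsCoupling (fun i => mixture (p i) (h i)) μ)
    (hνc : IsCoupling (fun i => mixture (q i) (h i)) ν)
    [IsProbabilityMeasure μ] [IsProbabilityMeasure ν] (hμ' : IsAdmissible T μ')
    {P : (Fin n → ℝ) × (Fin n → ℝ) → ℝ} (hP : Measurable P)
    (hPl : ∀ x y, ∑ i, v i * (if y i < x i then 1 else 0) ≤ P (x, y))
    (hPu : ∀ x y, P (x, y) ≤ ∑ i, v i * (if y i ≤ x i then 1 else 0)) :
    ∫ z, P z ∂(μ'.prod ν) ≤ ∫ z, P z ∂(μ.prod ν) := by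
  have := hμ'.isProbabilityMeasure
  have hPb : ∀ z, ‖P z‖ ≤ ∑ i, v i := by
    rintro ⟨x, y⟩
    rw [Real.norm_of_nonneg]
    · refine (hPu x y).trans (Finset.sum_le_sum fun i _ => ?_)
      split_ifs <;> simp [hv i]
    · refine le_trans (Finset.sum_nonneg fun i _ => ?_) (hPl x y)
      split_ifs <;> simp [hv i]
  have hPi : ∀ ρ : Measure ((Fin n → ℝ) × (Fin n → ℝ)), IsProbabilityMeasure ρ →
      Integrable P ρ := fun ρ _ =>
    Integrable.of_bound hP.aestronglyMeasurable _ (Filter.Eventually.of_forall hPb)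
  have hPyi : ∀ x, Integrable (fun y => P (x, y)) ν := fun x =>
    Integrable.of_bound (hP.comp measurable_prodMk_left).aestronglyMeasurable _
      (Filter.Eventually.of_forall fun y => hPb (x, y))
  have hind : ∀ (i : Fin n) (s : Set ℝ), MeasurableSet s → ∀ [DecidablePred (· ∈ s)],
      Integrable (fun y : Fin n → ℝ => v i * (if y i ∈ s then (1 : ℝ) else 0)) ν ∧
      ∫ y, v i * (if y i ∈ s then (1 : ℝ) else 0) ∂ν = v i * (mixture (q i) (h i)).real s := by
    intro i s hs _
    have hs' : MeasurableSet ((fun y : Fin n → ℝ => y i) ⁻¹' s) := measurable_pi_apply i hs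
    have e : (fun y : Fin n → ℝ => if y i ∈ s then (1 : ℝ) else 0)
        = ((fun y : Fin n → ℝ => y i) ⁻¹' s).indicator 1 := by
      funext y
      by_cases hy : y i ∈ s
      · rw [if_pos hy, Set.indicator_of_mem (show y ∈ (fun y : Fin n → ℝ => y i) ⁻¹' s from hy),
          Pi.one_apply]
      · rw [if_neg hy, Set.indicator_of_notMem (show y ∉ (fun y : Fin n → ℝ => y i) ⁻¹' s from hy)]
    constructor
    · refine Integrable.const_mul ?_ _
      rw [e]
      exact (integrable_const (1 : ℝ)).indicator hs'
    · rw [integral_const_mul, e, integral_indicator_one hs',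
        ← show _ = mixture (q i) (h i) from hνc i, map_measureReal_apply (measurable_pi_apply i) hs]
  -- Counting ties as wins and bounding each distribution function by its affine majorant; `hvκ`
  -- gives every battlefield the same slope κ.
  have hup : ∀ x : Fin n → ℝ, (∀ i, 0 ≤ x i) →
      ∫ y, P (x, y) ∂ν ≤ ∑ i, v i * (1 - q i) + κ * ∑ i, x i := by
    intro x hx
    have h1 : ∫ y, P (x, y) ∂ν ≤ ∫ y, ∑ i, v i * (if y i ∈ Set.Iic (x i) then 1 else 0) ∂ν :=
      integral_mono (hPyi x) (integrable_finsetSum _ fun i _ => (hind i _ measurableSet_Iic).1)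
        (hPu x)
    rw [integral_finsetSum _ fun i _ => (hind i _ measurableSet_Iic).1] at h1
    refine h1.trans ?_
    rw [Finset.mul_sum, ← Finset.sum_add_distrib]
    refine Finset.sum_le_sum fun i _ => ?_
    rw [(hind i _ measurableSet_Iic).2]
    refine (mul_le_mul_of_nonneg_left
      (mixture_real_Iic_le (hq0 i) (hq1 i) (hh i) (hx i)) (hv i)).trans_eq ?_
    rw [mul_add, ← mul_assoc, hvκ i]
    field_simp [(hh i).ne']
  -- Counting ties as losses still attains the affine bound: where the opponent may have an atom at
  -- 0 (q < 1), `hpq` gives p = 1, so x i > 0 almost surely.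
  have hlow : ∀ᵐ x ∂μ, ∑ i, (v i * (1 - q i) + κ * x i) ≤ ∫ y, P (x, y) ∂ν := by
    have hae : ∀ᵐ x ∂μ, ∀ i, x i ∈ Set.Icc 0 (h i) ∧ (q i = 1 ∨ 0 < x i) := by
      rw [ae_all_iff]
      intro i
      have : ∀ᵐ t ∂(mixture (p i) (h i)), t ∈ Set.Icc 0 (h i) ∧ (q i = 1 ∨ 0 < t) := by
        rcases hpq i with h1 | h1
        · rw [h1, mixture_one]
          filter_upwards [ae_unif (h i), ae_unif_pos (h i)] with t h1 h2 using ⟨h1, Or.inr h2⟩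
        · filter_upwards [ae_mixture_mem_Icc (hh i)] with t ht using ⟨ht, Or.inl h1⟩
      rw [← show _ = mixture (p i) (h i) from hμc i] at this
      exact ae_of_ae_map (measurable_pi_apply i).aemeasurable this
    filter_upwards [hae] with x hx
    have h1 : ∫ y, ∑ i, v i * (if y i ∈ Set.Iio (x i) then 1 else 0) ∂ν ≤ ∫ y, P (x, y) ∂ν :=
      integral_mono (integrable_finsetSum _ fun i _ => (hind i _ measurableSet_Iio).1) (hPyi x)
        (hPl x)
    rw [integral_finsetSum _ fun i _ => (hind i _ measurableSet_Iio).1] at h1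
    refine le_trans (Finset.sum_le_sum fun i _ => ?_) h1
    rw [(hind i _ measurableSet_Iio).2]
    refine le_of_eq_of_le ?_ (mul_le_mul_of_nonneg_left
      (le_mixture_real_Iio (hq0 i) (hq1 i) (hh i) (hx i).1.1 (hx i).1.2 (hx i).2) (hv i))
    rw [mul_add, ← mul_assoc, hvκ i]
    field_simp [(hh i).ne']
  have hxi : ∀ i, Integrable (fun x : Fin n → ℝ => x i) μ ∧ ∫ x, x i ∂μ = p i * (h i / 2) := by
    intro i
    have := isProbabilityMeasure_mixture (hp0 i) (hp1 i) (hh i)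
    have hi : Integrable (fun t => t) (mixture (p i) (h i)) := by
      refine Integrable.of_bound measurable_id.aestronglyMeasurable (h i) ?_
      filter_upwards [ae_mixture_mem_Icc (hh i)] with t ht
      rw [Real.norm_of_nonneg ht.1]
      exact ht.2
    have hm := integral_mixture (hp0 i) (hp1 i) (hh i) continuous_id
    rw [avg_id, id, mul_zero, zero_add] at hm
    simp only [id] at hm
    rw [← show _ = mixture (p i) (h i) from hμc i] at hi hm
    constructor
    · exact (integrable_map_measure measurable_id.aestronglyMeasurable
        (measurable_pi_apply i).aemeasurable).1 hi
    · rw [← hm]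
      exact (integral_map (φ := fun x : Fin n → ℝ => x i) (measurable_pi_apply i).aemeasurable
        measurable_id.aestronglyMeasurable).symm
  have hleft : ∫ z, P z ∂(μ'.prod ν) ≤ ∑ i, v i * (1 - q i) + κ * T := by
    rw [integral_prod _ (hPi _ inferInstance)]
    have h1 : ∀ᵐ x ∂μ', ∫ y, P (x, y) ∂ν ≤ ∑ i, v i * (1 - q i) + κ * T := by
      filter_upwards [hμ'.nonneg, hμ'.budget] with x hx hxT
      refine (hup x hx).trans ?_
      gcongr
    refine (integral_mono_ae (hPi _ inferInstance).integral_prod_left (integrable_const _)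
      h1).trans_eq ?_
    simp
  have hright : ∑ i, v i * (1 - q i) + κ * T ≤ ∫ z, P z ∂(μ.prod ν) := by
    rw [integral_prod _ (hPi _ inferInstance)]
    have hi : ∀ i, Integrable (fun x : Fin n → ℝ => v i * (1 - q i) + κ * x i) μ := fun i =>
      (integrable_const _).add ((hxi i).1.const_mul κ)
    refine le_of_eq_of_le ?_ (integral_mono_ae (integrable_finsetSum _ fun i _ => hi i)
      (hPi _ inferInstance).integral_prod_left hlow)
    rw [integral_finsetSum _ fun i _ => hi i]
    have e : ∀ i, ∫ x, (v i * (1 - q i) + κ * x i) ∂μ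
        = v i * (1 - q i) + κ / 2 * (p i * h i) := fun i => by
      rw [integral_add (integrable_const _) ((hxi i).1.const_mul κ), integral_const_mul κ, (hxi i).2,
        integral_const]
      simp
      ring
    rw [Finset.sum_congr rfl fun i _ => e i, Finset.sum_add_distrib, ← Finset.mul_sum, hsum]
    ring
  exact hleft.trans hright

lemma measurable_payoffA (G : Game n) (τ : TieRule n) :
    Measurable fun z : (Fin n → ℝ) × (Fin n → ℝ) => payoffA G τ z.1 z.2 := by
  unfold payoffA
  refine Finset.measurable_sum _ fun i _ => Measurable.const_mul ?_ _
  refine Measurable.ite (measurableSet_lt (by fun_prop) (by fun_prop)) measurable_const ?_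
  exact Measurable.ite (measurableSet_eq_fun (by fun_prop) (by fun_prop)) (τ.measurable_shareA i)
    measurable_const

lemma measurable_payoffB (G : Game n) (τ : TieRule n) :
    Measurable fun z : (Fin n → ℝ) × (Fin n → ℝ) => payoffB G τ z.1 z.2 := by
  unfold payoffB
  refine Finset.measurable_sum _ fun i _ => Measurable.const_mul ?_ _
  refine Measurable.ite (measurableSet_lt (by fun_prop) (by fun_prop)) measurable_const ?_
  exact Measurable.ite (measurableSet_eq_fun (by fun_prop) (by fun_prop))
    (measurable_const.sub (τ.measurable_shareA i)) measurable_const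

/-- This sandwich between strict and weak wins is all that is used about the tie rule. -/
lemma reward_bounds {a b s : ℝ} (h0 : 0 ≤ s) (h1 : s ≤ 1) :
    (if b < a then (1 : ℝ) else 0) ≤ (if b < a then 1 else if a = b then s else 0) ∧
      (if b < a then (1 : ℝ) else if a = b then s else 0) ≤ (if b ≤ a then 1 else 0) := by
  rcases lt_trichotomy b a with h | h | h
  · simp [h, h.le]
  · simp [h, h0, h1]
  · simp [h.not_gt, h.ne, h.not_ge]

/-! ### The Lotto parameters in mixture form -/

open Classical in
/-- The probability with which `A` is active on battlefield `i` in the Lotto equilibrium. -/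
noncomputable def activeA (G : Game n) (γ : ℝ) (i : Fin n) : ℝ :=
  if i ∈ highSet G γ then 1 else G.vA i / (γ * G.vB i)

open Classical in
/-- The probability with which `B` is active on battlefield `i` in the Lotto equilibrium. -/
noncomputable def activeB (G : Game n) (γ : ℝ) (i : Fin n) : ℝ :=
  if i ∈ highSet G γ then γ * G.vB i / G.vA i else 1

/-- The largest allocation on battlefield `i` in the Lotto equilibrium. -/
noncomputable def maxAlloc (G : Game n) (γ l : ℝ) (i : Fin n) : ℝ :=
  min (γ * G.vB i) (G.vA i) / l

lemma mem_highSet {G : Game n} {γ : ℝ} {i : Fin n} :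
    i ∈ highSet G γ ↔ γ * G.vB i ≤ G.vA i := by
  rw [highSet, Set.mem_ofPred_eq, le_div_iff₀ (G.vB_pos i)]

lemma lottoA_eq (G : Game n) (γ l : ℝ) (i : Fin n) :
    lottoA G γ l i = mixture (activeA G γ i) (maxAlloc G γ l i) := by
  unfold lottoA activeA maxAlloc
  split_ifs with h
  · rw [mixture_one, min_eq_left (mem_highSet.1 h)]
  · rw [min_eq_right (not_le.1 (mt mem_highSet.2 h)).le]

lemma lottoB_eq (G : Game n) (γ l : ℝ) (i : Fin n) :
    lottoB G γ l i = mixture (activeB G γ i) (maxAlloc G γ l i) := by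
  unfold lottoB activeB maxAlloc
  split_ifs with h
  · rw [min_eq_left (mem_highSet.1 h)]
  · rw [mixture_one, min_eq_right (not_le.1 (mt mem_highSet.2 h)).le]

section params

variable {G : Game n} {γ l : ℝ}

lemma maxAlloc_pos (h : IsLottoParams G γ l) (i : Fin n) : 0 < maxAlloc G γ l i :=
  div_pos (lt_min (mul_pos h.gamma_pos (G.vB_pos i)) (G.vA_pos i)) h.lambda_pos

lemma activeA_pos (h : IsLottoParams G γ l) (i : Fin n) : 0 < activeA G γ i := by
  unfold activeA
  split_ifs
  exacts [one_pos, div_pos (G.vA_pos i) (mul_pos h.gamma_pos (G.vB_pos i))]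

lemma activeB_pos (h : IsLottoParams G γ l) (i : Fin n) : 0 < activeB G γ i := by
  unfold activeB
  split_ifs
  exacts [div_pos (mul_pos h.gamma_pos (G.vB_pos i)) (G.vA_pos i), one_pos]

lemma activeA_le_one (h : IsLottoParams G γ l) (i : Fin n) : activeA G γ i ≤ 1 := by
  unfold activeA
  split_ifs with hi
  · exact le_rfl
  · exact (div_le_one (mul_pos h.gamma_pos (G.vB_pos i))).2 (not_le.1 (mt mem_highSet.2 hi)).le

lemma activeB_le_one (i : Fin n) : activeB G γ i ≤ 1 := by
  unfold activeB
  split_ifs with hi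
  · exact (div_le_one (G.vA_pos i)).2 (mem_highSet.1 hi)
  · exact le_rfl

lemma activeA_eq_one_or (i : Fin n) : activeA G γ i = 1 ∨ activeB G γ i = 1 := by
  unfold activeA activeB
  split_ifs
  exacts [Or.inl rfl, Or.inr rfl]

/-- The marginal reward of an extra unit is the same on all battlefields: `l` for `A`, and `l / γ`
for `B` in `vB_mul_activeA`. -/
lemma vA_mul_activeB (h : IsLottoParams G γ l) (i : Fin n) :
    G.vA i * activeB G γ i = l * maxAlloc G γ l i := by
  have hl := h.lambda_pos.ne'
  have ha := (G.vA_pos i).ne'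
  unfold activeB maxAlloc
  split_ifs with hi
  · rw [min_eq_left (mem_highSet.1 hi)]
    field_simp
  · rw [min_eq_right (not_le.1 (mt mem_highSet.2 hi)).le]
    field_simp

lemma vB_mul_activeA (h : IsLottoParams G γ l) (i : Fin n) :
    G.vB i * activeA G γ i = l / γ * maxAlloc G γ l i := by
  have hl := h.lambda_pos.ne'
  have hγ := h.gamma_pos.ne'
  have hb := (G.vB_pos i).ne'
  unfold activeA maxAlloc
  split_ifs with hi
  · rw [min_eq_left (mem_highSet.1 hi)]
    field_simp
  · rw [min_eq_right (not_le.1 (mt mem_highSet.2 hi)).le]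
    field_simp

/-- Since the mixture has mean p h / 2, this says that the expected total equals the budget. -/
lemma sum_activeA_mul_maxAlloc (h : IsLottoParams G γ l) :
    ∑ i, activeA G γ i * maxAlloc G γ l i = 2 * G.TA := by
  have hl := h.lambda_pos
  have e : ∀ i, l * (activeA G γ i * maxAlloc G γ l i)
      = min (γ * G.vB i) (G.vA i ^ 2 / (γ * G.vB i)) := fun i => by
    have hb := mul_pos h.gamma_pos (G.vB_pos i)
    have ha := G.vA_pos i
    unfold activeA maxAlloc
    split_ifs with hi
    · rw [mem_highSet] at hi
      rw [min_eq_left hi, min_eq_left]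
      · field_simp
      · rw [le_div_iff₀ hb]
        nlinarith
    · rw [mem_highSet, not_le] at hi
      rw [min_eq_right hi.le, min_eq_right]
      · field_simp
      · rw [div_le_iff₀ hb]
        nlinarith
  have h2 := h.budgetA
  rw [← Finset.sum_congr rfl fun i _ => e i, ← Finset.mul_sum] at h2
  refine mul_left_cancel₀ hl.ne' ?_
  linarith

lemma sum_activeB_mul_maxAlloc (h : IsLottoParams G γ l) :
    ∑ i, activeB G γ i * maxAlloc G γ l i = 2 * G.TB := by
  have hl := h.lambda_pos
  have e : ∀ i, l * (activeB G γ i * maxAlloc G γ l i)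
      = min ((γ * G.vB i) ^ 2 / G.vA i) (G.vA i) := fun i => by
    have hb := mul_pos h.gamma_pos (G.vB_pos i)
    have ha := G.vA_pos i
    unfold activeB maxAlloc
    split_ifs with hi
    · rw [mem_highSet] at hi
      rw [min_eq_left hi, min_eq_left]
      · field_simp
      · rw [div_le_iff₀ ha]
        nlinarith
    · rw [mem_highSet, not_le] at hi
      rw [min_eq_right hi.le, min_eq_right]
      · field_simp
      · rw [le_div_iff₀ ha]
        nlinarith
  have h2 := h.budgetB
  rw [← Finset.sum_congr rfl fun i _ => e i, ← Finset.mul_sum] at h2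
  refine mul_left_cancel₀ hl.ne' ?_
  linarith

end params

/-! ### Equilibrium and necessity -/

/-- Admissible couplings of the Lotto marginals form a Nash equilibrium. -/
lemma isNash_of_isCoupling {G : Game n} (τ : TieRule n) {γ l : ℝ} (h : IsLottoParams G γ l)
    {μ ν : Measure (Fin n → ℝ)} (hμ : IsCoupling (lottoA G γ l) μ)
    (hν : IsCoupling (lottoB G γ l) ν) (hμa : IsAdmissible G.TA μ) (hνa : IsAdmissible G.TB ν) :
    IsNash G τ μ ν := by
  have := hμa.isProbabilityMeasure
  have := hνa.isProbabilityMeasure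
  rw [show lottoA G γ l = _ from funext (lottoA_eq G γ l)] at hμ
  rw [show lottoB G γ l = _ from funext (lottoB_eq G γ l)] at hν
  refine ⟨hμa, hνa, fun μ' hμ' => ?_, fun ν' hν' => ?_⟩
  · refine expected_le_of_lotto h.lambda_pos.le (fun i => (G.vA_pos i).le)
      (fun i => (activeA_pos h i).le) (activeA_le_one h) (fun i => (activeB_pos h i).le)
      activeB_le_one activeA_eq_one_or (maxAlloc_pos h) (vA_mul_activeB h)
      (sum_activeA_mul_maxAlloc h) hμ hν hμ' (measurable_payoffA G τ)
      (fun x y => Finset.sum_le_sum fun i _ => mul_le_mul_of_nonneg_left ?_ (G.vA_pos i).le)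
      (fun x y => Finset.sum_le_sum fun i _ => mul_le_mul_of_nonneg_left ?_ (G.vA_pos i).le)
    · exact (reward_bounds (τ.shareA_nonneg i x y) (τ.shareA_le_one i x y)).1
    · exact (reward_bounds (τ.shareA_nonneg i x y) (τ.shareA_le_one i x y)).2
  · have := hν'.isProbabilityMeasure
    have key := expected_le_of_lotto (P := fun z => payoffB G τ z.2 z.1)
      (div_pos h.lambda_pos h.gamma_pos).le (fun i => (G.vB_pos i).le)
      (fun i => (activeB_pos h i).le) activeB_le_one (fun i => (activeA_pos h i).le)
      (activeA_le_one h) (fun i => (activeA_eq_one_or i).symm) (maxAlloc_pos h)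
      (vB_mul_activeA h) (sum_activeB_mul_maxAlloc h) hν hμ hν'
      ((measurable_payoffB G τ).comp measurable_swap)
      (fun x y => Finset.sum_le_sum fun i _ => mul_le_mul_of_nonneg_left ?_ (G.vB_pos i).le)
      (fun x y => Finset.sum_le_sum fun i _ => mul_le_mul_of_nonneg_left ?_ (G.vB_pos i).le)
    · unfold expectedB
      rw [← integral_prod_swap, ← integral_prod_swap (μ := μ)]
      exact key
    all_goals
      have hb := reward_bounds (a := x i) (b := y i) (sub_nonneg.2 (τ.shareA_le_one i y x))
        (sub_le_self 1 (τ.shareA_nonneg i y x))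
      simp only [eq_comm (a := x i)] at hb
    exacts [hb.1, hb.2]

/-- An admissible strategy cannot have a marginal charging allocations above the budget. -/
lemma le_budget_of_isCoupling_mixture {p h : Fin n → ℝ} {T : ℝ} (hp0 : ∀ i, 0 < p i)
    (hp1 : ∀ i, p i ≤ 1) (hh : ∀ i, 0 < h i) {ν : Measure (Fin n → ℝ)}
    (hc : IsCoupling (fun i => mixture (p i) (h i)) ν) (hν : IsAdmissible T ν) (hT : 0 ≤ T)
    (i : Fin n) : h i ≤ T := by
  by_contra! hlt
  have := isProbabilityMeasure_mixture (hp0 i).le (hp1 i) (hh i)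
  have h1 : ∀ᵐ x ∂ν, x i ≤ T := by
    filter_upwards [hν.nonneg, hν.budget] with x hx hxT
    exact (Finset.single_le_sum (fun i _ => hx i) (Finset.mem_univ i)).trans hxT
  have h2 : ∀ᵐ t ∂(mixture (p i) (h i)), t ∈ Set.Iic T := by
    rw [← show _ = mixture (p i) (h i) from hc i]
    have hs : MeasurableSet {t : ℝ | t ∈ Set.Iic T} := measurableSet_Iic
    exact (ae_map_iff (f := fun x : Fin n → ℝ => x i) (measurable_pi_apply i).aemeasurable hs).2 h1
  have h3 : (mixture (p i) (h i)).real (Set.Iic T) = 1 := by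
    rw [measureReal_def, prob_compl_eq_zero_iff measurableSet_Iic |>.1 h2]
    simp
  -- The probability of staying within the budget is at most 1 - p + p T / h, which is below 1 when
  -- h > T.
  have h4 := mixture_real_Iic_le (hp0 i).le (hp1 i) (hh i) hT
  have h5 : p i * (T / h i) < p i * 1 :=
    mul_lt_mul_of_pos_left ((div_lt_one (hh i)).2 hlt) (hp0 i)
  linarith

end Blotto

theorem theorem1 {n : ℕ} (G : Blotto.Game n) (τ : Blotto.TieRule n) (γ l : ℝ)
    (h : Blotto.IsLottoParams G γ l) :
    (∃ μ ν : MeasureTheory.Measure (Fin n → ℝ),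
        Blotto.IsCoupling (Blotto.lottoA G γ l) μ ∧
        Blotto.IsCoupling (Blotto.lottoB G γ l) ν ∧
        Blotto.IsNash G τ μ ν) ↔
      (⨆ i, min (γ * G.vB i) (G.vA i)) ≤ l * G.TB := by
  have hn : Nonempty (Fin n) := ⟨⟨0, by have := G.two_le; omega⟩⟩
  have hiff : (⨆ i, min (γ * G.vB i) (G.vA i)) ≤ l * G.TB ↔
      ∀ i, Blotto.maxAlloc G γ l i ≤ G.TB := by
    rw [ciSup_le_iff (Set.finite_range _).bddAbove]
    refine forall_congr' fun i => ?_
    rw [Blotto.maxAlloc, div_le_iff₀' h.lambda_pos]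
  rw [hiff]
  have eA := funext (Blotto.lottoA_eq G γ l)
  have eB := funext (Blotto.lottoB_eq G γ l)
  constructor
  · rintro ⟨μ, ν, -, hν, hN⟩
    rw [eB] at hν
    exact Blotto.le_budget_of_isCoupling_mixture (Blotto.activeB_pos h) Blotto.activeB_le_one
      (Blotto.maxAlloc_pos h) hν hN.admissibleB G.TB_pos.le
  · intro hT
    -- Both players share the maximal allocations, so the bound by `TB` also gives `A`'s condition
    -- through `TB ≤ TA`.
    obtain ⟨μ, hμ, hμa⟩ := Blotto.exists_coupling_mixture G.two_le
      (G.TB_pos.trans_le G.TB_le_TA) (fun i => (Blotto.activeA_pos h i).le)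
      (Blotto.activeA_le_one h) (Blotto.maxAlloc_pos h) (fun i => (hT i).trans G.TB_le_TA)
      (Blotto.sum_activeA_mul_maxAlloc h)
    obtain ⟨ν, hν, hνa⟩ := Blotto.exists_coupling_mixture G.two_le G.TB_pos
      (fun i => (Blotto.activeB_pos h i).le) Blotto.activeB_le_one (Blotto.maxAlloc_pos h) hT
      (Blotto.sum_activeB_mul_maxAlloc h)
    rw [← eA] at hμ
    rw [← eB] at hν
    exact ⟨μ, ν, hμ, hν, Blotto.isNash_of_isCoupling τ h hμ hν hμa hνa⟩
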